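/- Let $G$ be a finite connected multigraph without loops (parallel edges allowed), embedded in the plane. The embedding is given by its standard combinatorial data: the counterclockwise cyclic order of the edge-ends at each vertex, such that the surface obtained by gluing a disc to every closed walk that follows this order (a face) is the sphere, i.e. $|V|-|E|+|F|=2$, together with the choice of the unbounded face. Fix an orientation of every edge of $G$. The face cycle of a bounded face is its boundary walk, run clockwise. Let $B_f$ be the integer matrix with rows indexed by the bounded faces and columns indexed by the edges, whose entry at $(f,e)$ is $1$ if the face cycle of $f$ runs through $e$ along its orientation, $-1$ if it runs through $e$ against its orientation, and $0$ if $e$ is not on the boundary of $f$ or is run through once in each direction. Put $\mathbf{B}_G = B_f B_f^{T}$. Let $L_G = D_G - A_G$ be the Laplacian of $G$ (degree matrix minus adjacency matrix), and for a vertex $v$ let $\widetilde{L}_G$ be the reduced Laplacian obtained by deleting the row and the column of $v$. Let $\mathrm{Jac}(G)$ be the group of divisors of degree $0$ on $G$ (integer combinations of vertices with coefficient sum $0$) modulo the subgroup generated by the elements $\sum_{vw\in E(G)}(w-v)$, $v\in V(G)$. Then, for every vertex $v$, the matrices $\mathbf{B}_G$ and $\widetilde{L}_G$ have the same invariant factors,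 that is, their Smith normal forms over $\mathbb{Z}$ have the same diagonal entries apart from entries equal to $1$ (the two matrices may have different sizes). Moreover, $\mathrm{Jac}(G)$ is isomorphic to the cokernel $\mathbb{Z}^{F_b}/\mathbf{B}_G\mathbb{Z}^{F_b}$, where $F_b$ is the set of bounded faces. -/

import Mathlib

open scoped Graph

noncomputable section

namespace Graph

variable {α β : Type*}

/-- A multigraph is connected if it has a vertex and any two vertices are joined by a walk. -/
def IsConnected (G : Graph α β) : Prop :=
  V(G).Nonempty ∧ ∀ x ∈ V(G), ∀ y ∈ V(G), Relation.ReflTransGen G.Adj x y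

/-! ### Laplacians -/

/-- The adjacency matrix `A_G`: the entry at `(x, y)` is the number of edges joining `x` and `y`. -/
def adjMatrix (G : Graph α β) : Matrix V(G) V(G) ℤ :=
  Matrix.of fun x y => ({e | G.IsLink e x y}.ncard : ℤ)

open Classical in
/-- The degree matrix `D_G` of a loopless graph: the diagonal entry at `x` is the number of edges
incident with `x`. -/
def degreeMatrix (G : Graph α β) : Matrix V(G) V(G) ℤ :=
  Matrix.diagonal fun x => ((G.incidenceSet (x : α)).ncard : ℤ)

/-- The Laplacian `L_G = D_G - A_G`. -/
def laplacian (G : Graph α β) : Matrix V(G) V(G) ℤ :=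
  G.degreeMatrix - G.adjMatrix

instance (G : Graph α β) [Fintype V(G)] (v : V(G)) : Fintype {x : V(G) // x ≠ v} :=
  Fintype.ofFinite _

/-- The reduced Laplacian: the row and the column of the vertex `v` are deleted. -/
def reducedLaplacian (G : Graph α β) (v : V(G)) :
    Matrix {x : V(G) // x ≠ v} {x : V(G) // x ≠ v} ℤ :=
  G.laplacian.submatrix Subtype.val Subtype.val

/-! ### Divisors, the Picard group and the Jacobian -/

/-- Divisors on a finite graph: integer combinations of vertices. -/
abbrev Div (G : Graph α β) : Type _ := V(G) → ℤ

open Classical in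
/-- The change of a divisor under a lending move at `v`: the sum of `w - v` over all edges `vw`
(with multiplicity). A borrowing move at `v` subtracts this divisor. -/
def lending (G : Graph α β) [Fintype V(G)] (v : V(G)) : G.Div :=
  ∑ w : V(G), G.adjMatrix v w • (Pi.single w 1 - Pi.single v 1)

/-- Two divisors differ by an element of this subgroup if and only if one is obtained from the other
by a finite sequence of lending and borrowing moves. -/
def principal (G : Graph α β) [Fintype V(G)] : AddSubgroup G.Div :=
  AddSubgroup.closure (Set.range G.lending)

/-- The Picard group: divisors up to lending and borrowing moves. -/
abbrev Pic (G : Graph α β) [Fintype V(G)] : Type _ := G.Div ⧸ G.principal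

/-- The degree of a divisor. -/
def degDiv (G : Graph α β) [Fintype V(G)] : G.Div →+ ℤ where
  toFun D := ∑ v, D v
  map_zero' := by simp
  map_add' D D' := by simp [Finset.sum_add_distrib]

theorem principal_le_ker_degDiv (G : Graph α β) [Fintype V(G)] :
    G.principal ≤ G.degDiv.ker := by
  classical
  have hs : ∀ w : V(G), G.degDiv (Pi.single w 1) = 1 := fun w => by
    simp [degDiv, Pi.single_apply]
  refine (AddSubgroup.closure_le _).2 ?_
  rintro _ ⟨v, rfl⟩
  have : G.degDiv (G.lending v) = 0 := by
    unfold lending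
    rw [map_sum]
    refine Finset.sum_eq_zero fun w _ => ?_
    have h1 : Pi.single (M := fun _ : V(G) => ℤ) w 1 = fun i => if i = w then 1 else 0 := by
      ext i; simp [Pi.single_apply]
    rw [map_zsmul, map_sub, hs, hs, sub_self, smul_zero]
  exact this

/-- The degree homomorphism on the Picard group. -/
def degPic (G : Graph α β) [Fintype V(G)] : G.Pic →+ ℤ :=
  QuotientAddGroup.lift G.principal G.degDiv G.principal_le_ker_degDiv

/-- The Jacobian: the group of divisor classes of degree `0`. -/
abbrev Jac (G : Graph α β) [Fintype V(G)] : Type _ := G.degPic.ker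

/-! ### Plane embeddings

An embedding of a connected graph in the oriented sphere is described, up to orientation preserving
homeomorphism, by the cyclic order of the edge-ends around each vertex. The regions of the
complement are then traced by walking along the edges, and the surface so described is the sphere
exactly when its Euler characteristic is `2`. An embedding in the plane is an embedding in the
sphere together with the region that contains the point at infinity. -/

/-- A directed edge. An edge that is not a loop carries exactly two darts. -/
@[ext]
structure Dart (G : Graph α β) where
  /-- The underlying edge. -/
  edge : E(G)
  /-- The starting vertex. -/
  src : V(G)
  /-- The final vertex. -/
  tgt : V(G)
  isLink : G.IsLink (edge : β) (src : α) (tgt : α)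

instance (G : Graph α β) [Finite V(G)] [Finite E(G)] : Finite G.Dart :=
  Finite.of_injective (fun d : G.Dart => (d.edge, d.src, d.tgt)) fun d d' h => by
    simp only [Prod.mk.injEq] at h
    exact Dart.ext h.1 h.2.1 h.2.2

/-- Reversal of darts. -/
def rev (G : Graph α β) : Equiv.Perm G.Dart where
  toFun d := ⟨d.edge, d.tgt, d.src, d.isLink.symm⟩
  invFun d := ⟨d.edge, d.tgt, d.src, d.isLink.symm⟩
  left_inv _ := rfl
  right_inv _ := rfl

/-- An orientation of a graph: a choice of a dart on every edge. -/
structure Orientation (G : Graph α β) where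
  /-- The chosen dart. -/
  dart : E(G) → G.Dart
  edge_dart : ∀ e, (dart e).edge = e

/-- A rotation system: a cyclic (say counterclockwise) order on the darts that start at each
vertex. -/
structure RotationSystem (G : Graph α β) where
  /-- The next dart, counterclockwise, around the starting vertex of a dart. -/
  rot : Equiv.Perm G.Dart
  src_rot : ∀ d, (rot d).src = d.src
  sameCycle : ∀ d d' : G.Dart, d.src = d'.src → rot.SameCycle d d'

namespace RotationSystem

variable {G : Graph α β}

/-- The step of a walk around a region that keeps the region on its right hand: run along the dart
to its final vertex and leave that vertex by the next dart, counterclockwise. -/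
def facePerm (R : G.RotationSystem) : Equiv.Perm G.Dart :=
  G.rev.trans R.rot

/-- The corners of the regions: one for every dart, and one at each vertex without edges (so that
the one-vertex graph has one region). -/
abbrev Corner (G : Graph α β) : Type _ := G.Dart ⊕ {v : V(G) // ∀ e, ¬ G.Inc e (v : α)}

/-- `facePerm` on corners; the corner at a vertex without edges is fixed. -/
def cornerPerm (R : G.RotationSystem) : Equiv.Perm (Corner G) :=
  Equiv.Perm.sumCongr R.facePerm 1

/-- The faces: the closed walks around the regions of the complement of the embedded graph. -/
def Face (R : G.RotationSystem) : Type _ :=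
  Quotient (Equiv.Perm.SameCycle.setoid R.cornerPerm)

instance (R : G.RotationSystem) [Finite V(G)] [Finite E(G)] : Finite R.Face :=
  inferInstanceAs (Finite (Quotient _))

/-- The face that lies to the right of a dart. -/
def faceOf (R : G.RotationSystem) (d : G.Dart) : R.Face :=
  Quotient.mk (Equiv.Perm.SameCycle.setoid R.cornerPerm) (Sum.inl d)

/-- The closed oriented surface described by the rotation system of a connected graph is the sphere:
its Euler characteristic `|V| - |E| + |F|` is `2`. -/
def IsSpherical (R : G.RotationSystem) : Prop :=
  (Nat.card V(G) : ℤ) - Nat.card E(G) + Nat.card R.Face = 2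

end RotationSystem

/-- An embedding of a connected graph in the plane, given by its combinatorial data: the rotations
at the vertices and the unbounded face. -/
structure PlaneEmbedding (G : Graph α β) extends RotationSystem G where
  isSpherical : toRotationSystem.IsSpherical
  /-- The unbounded face. -/
  outer : toRotationSystem.Face

namespace PlaneEmbedding

variable {G : Graph α β}

/-- The bounded faces. -/
abbrev BoundedFace (P : G.PlaneEmbedding) : Type _ :=
  {f : P.toRotationSystem.Face // f ≠ P.outer}

instance (P : G.PlaneEmbedding) [Finite V(G)] [Finite E(G)] : Fintype P.BoundedFace :=
  Fintype.ofFinite _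

open Classical in
/-- The face cycle matrix `B_f`, with rows indexed by the bounded faces and columns by the edges.
The face cycle of a bounded face is its boundary walk, run clockwise (the face is on the right). The
entry is `1` if the face cycle runs through the edge along its orientation, `-1` if it does so
against it, and `0` if the edge is not on the boundary of the face or is run through once in each
direction. -/
def faceCycleMatrix (P : G.PlaneEmbedding) (o : G.Orientation) : Matrix P.BoundedFace E(G) ℤ :=
  Matrix.of fun f e =>
    (if P.faceOf (o.dart e) = f then 1 else 0) - (if P.faceOf (G.rev (o.dart e)) = f then 1 else 0)

/-- The matrix `𝐁_G = B_f B_fᵀ`. -/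
def faceGramMatrix (P : G.PlaneEmbedding) [Fintype E(G)] (o : G.Orientation) :
    Matrix P.BoundedFace P.BoundedFace ℤ :=
  P.faceCycleMatrix o * (P.faceCycleMatrix o).transpose

end PlaneEmbedding

end Graph

open Classical in
/-- The list of the invariant factors different from `1` of a square integer matrix `A` is `s`: the
Smith normal form of `A` is the diagonal matrix with entries `1, …, 1, s₁, s₂, …`, where each
entry divides the next one. -/
def HasInvariantFactors {n : Type*} [Fintype n] (A : Matrix n n ℤ) (s : List ℕ) : Prop :=
  1 ∉ s ∧ s.IsChain (· ∣ ·) ∧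
    ∃ (k : ℕ) (σ : n ≃ Fin (List.replicate k 1 ++ s).length) (P Q : Matrix n n ℤ),
      IsUnit P.det ∧ IsUnit Q.det ∧
        P * A * Q = Matrix.diagonal fun i => (((List.replicate k 1 ++ s).get (σ i) : ℕ) : ℤ)

end

/-!
Let `A` be the face cycle matrix and let `C` be the signed incidence matrix of `G` without the row
of `v`, so that `𝐁_G = A Aᵀ` and the reduced Laplacian is `C Cᵀ`. Four facts about these matrices
suffice.

* `A Cᵀ = 0`, because the boundary walk of a face is closed.
* `C` is surjective over `ℤ`, because `G` is connected.
* `A` is surjective over `ℤ`, because the dual graph is connected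
  (`Graph.RotationSystem.eqvGen_face`); up to the choice of a root, `A` is the reduced signed
  incidence matrix of the dual graph, so both surjectivity statements are instances of
  `Matrix.signedIncidence_submatrix_mulVec_surjective`.
* The numbers of rows of `A` and `C` add up to the number of edges, by Euler's formula.

Hence `Aᵀ` and `C` form a split exact sequence with the edge lattice in the middle
(`Matrix.exists_splitting`): the kernel of `C` is the image of `Aᵀ`, the kernel of `A` is the image
of `Cᵀ`, and both remain true modulo every `m`.

For the invariant factors, the solutions of `A Aᵀ y = 0` modulo `m` and those of `C Cᵀ z = 0` are
both parametrized by the intersection of the images of `Aᵀ` and `Cᵀ`, so there are equally many. A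
matrix with invariant factors `d₁ ∣ d₂ ∣ …` has `∏ gcd (dᵢ, m)` such solutions, and these numbers
determine the `dᵢ` up to entries `1` (`List.eq_of_prod_gcd_eq`). Existence of the Smith normal form
is proved by reduction to a pivot of least absolute value.

For the Jacobian, the edge lattice surjects both onto `Jac G` (by the boundary map) and onto the
cokernel of `A Aᵀ` (by `A`), and the kernel of either map is the sum of the images of `Aᵀ` and
`Cᵀ`.
-/

noncomputable section

/-! ### Smith normal form of integer matrices -/

namespace Matrix

variable {n p : Type*} [Fintype n] [DecidableEq n] [Fintype p] [DecidableEq p]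

/-- Two square integer matrices are unimodularly equivalent if invertible row and column
operations over `ℤ` turn one into the other. -/
def UnimodularEquiv (A B : Matrix n n ℤ) : Prop :=
  ∃ P Q : Matrix n n ℤ, IsUnit P.det ∧ IsUnit Q.det ∧ P * A * Q = B

namespace UnimodularEquiv

theorem refl (A : Matrix n n ℤ) : UnimodularEquiv A A :=
  ⟨1, 1, by simp, by simp, by simp⟩

theorem trans {A B C : Matrix n n ℤ} (h : UnimodularEquiv A B) (h' : UnimodularEquiv B C) :
    UnimodularEquiv A C := by
  obtain ⟨P, Q, hP, hQ, rfl⟩ := h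
  obtain ⟨P', Q', hP', hQ', rfl⟩ := h'
  refine ⟨P' * P, Q * Q', ?_, ?_, by simp only [Matrix.mul_assoc]⟩
  · rw [det_mul]; exact hP'.mul hP
  · rw [det_mul]; exact hQ.mul hQ'

theorem symm {A B : Matrix n n ℤ} (h : UnimodularEquiv A B) : UnimodularEquiv B A := by
  obtain ⟨P, Q, hP, hQ, rfl⟩ := h
  refine ⟨P⁻¹, Q⁻¹, isUnit_nonsing_inv_det P hP, isUnit_nonsing_inv_det Q hQ, ?_⟩
  rw [Matrix.mul_assoc P, nonsing_inv_mul_cancel_left _ _ hP, mul_nonsing_inv_cancel_right _ _ hQ]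

theorem mul_left {P : Matrix n n ℤ} (hP : IsUnit P.det) (A : Matrix n n ℤ) :
    UnimodularEquiv A (P * A) := ⟨P, 1, hP, by simp, by simp⟩

theorem mul_right {Q : Matrix n n ℤ} (hQ : IsUnit Q.det) (A : Matrix n n ℤ) :
    UnimodularEquiv A (A * Q) := ⟨1, Q, by simp, hQ, by simp⟩

theorem rowOp (A : Matrix n n ℤ) {i j : n} (h : i ≠ j) (c : ℤ) :
    UnimodularEquiv A (transvection i j c * A) :=
  mul_left (by simp [det_transvection_of_ne _ _ h]) A

theorem colOp (A : Matrix n n ℤ) {i j : n} (h : i ≠ j) (c : ℤ) :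
    UnimodularEquiv A (A * transvection i j c) :=
  mul_right (by simp [det_transvection_of_ne _ _ h]) A

theorem submatrix_perm (A : Matrix n n ℤ) (σ τ : Equiv.Perm n) :
    UnimodularEquiv A (A.submatrix σ τ) := by
  refine ⟨(1 : Matrix n n ℤ).submatrix σ id, (1 : Matrix n n ℤ).submatrix id τ, ?_, ?_, ?_⟩
  · rw [det_permute]; simp
  · rw [det_permute']; simp
  · ext i j
    simp [Matrix.mul_apply, Matrix.one_apply]

theorem submatrix {A B : Matrix n n ℤ} (h : UnimodularEquiv A B) (e : p ≃ n) :
    UnimodularEquiv (A.submatrix e e) (B.submatrix e e) := by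
  obtain ⟨P, Q, hP, hQ, rfl⟩ := h
  exact ⟨P.submatrix e e, Q.submatrix e e, by simpa using hP, by simpa using hQ, by
    simp [Matrix.submatrix_mul_equiv]⟩

theorem dvd {A B : Matrix n n ℤ} (h : UnimodularEquiv A B) {b : ℤ} (hb : ∀ i j, b ∣ A i j)
    (i j : n) : b ∣ B i j := by
  obtain ⟨P, Q, -, -, rfl⟩ := h
  simp only [Matrix.mul_apply]
  exact Finset.dvd_sum fun k _ => Dvd.dvd.mul_right
    (Finset.dvd_sum fun l _ => Dvd.dvd.mul_left (hb _ _) _) _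

end UnimodularEquiv

/-- An entry of least nonzero absolute value among all matrices equivalent to `A` divides every
entry of its matrix: otherwise a row or column operation would leave a smaller remainder. -/
theorem exists_unimodularEquiv_pivot {A : Matrix n n ℤ} (hA : A ≠ 0) :
    ∃ B, UnimodularEquiv A B ∧ ∃ i j, ∀ k l, B i j ∣ B k l := by
  classical
  let S : ℕ → Prop := fun m => m ≠ 0 ∧ ∃ B, UnimodularEquiv A B ∧ ∃ i j, (B i j).natAbs = m
  have hS : ∃ m, S m := by
    have : ∃ i j, A i j ≠ 0 := by
      by_contra! h
      exact hA (by ext i j; exact h i j)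
    obtain ⟨i, j, h⟩ := this
    exact ⟨_, by simpa using h, A, .refl A, i, j, rfl⟩
  obtain ⟨h0, B, hB, i, j, hij⟩ := Nat.find_spec hS
  have hmin : ∀ B', UnimodularEquiv A B' → ∀ k l, (B' k l).natAbs < (B i j).natAbs →
      B' k l = 0 := by
    intro B' hB' k l hlt
    by_contra hne
    exact Nat.find_min hS (hij ▸ hlt) ⟨by simpa using hne, B', hB', k, l, rfl⟩
  have hb0 : B i j ≠ 0 := by rw [← hij] at h0; simpa using h0
  have hmod : ∀ x : ℤ, (x % B i j).natAbs < (B i j).natAbs := fun x => by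
    have h1 := Int.emod_nonneg x hb0
    have h2 := Int.emod_lt_abs x hb0
    rw [Int.abs_eq_natAbs] at h2
    omega
  have hcol : ∀ B', UnimodularEquiv A B' → B' i j = B i j → ∀ k, B i j ∣ B' k j := by
    intro B' hB' he k
    rcases eq_or_ne k i with rfl | hk
    · rw [he]
    have := hmin _ (hB'.trans (.rowOp B' hk (-(B' k j / B i j)))) k j
    rw [transvection_mul_apply_same, he,
      show B' k j + -(B' k j / B i j) * B i j = B' k j % B i j by rw [Int.emod_def]; ring] at this
    exact Int.dvd_of_emod_eq_zero (this (hmod _))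
  have hrow : ∀ B', UnimodularEquiv A B' → B' i j = B i j → ∀ l, B i j ∣ B' i l := by
    intro B' hB' he l
    rcases eq_or_ne l j with rfl | hl
    · rw [he]
    have := hmin _ (hB'.trans (.colOp B' hl.symm (-(B' i l / B i j)))) i l
    rw [mul_transvection_apply_same, he,
      show B' i l + -(B' i l / B i j) * B i j = B' i l % B i j by rw [Int.emod_def]; ring] at this
    exact Int.dvd_of_emod_eq_zero (this (hmod _))
  refine ⟨B, hB, i, j, fun k l => ?_⟩
  rcases eq_or_ne k i with rfl | hk
  · exact hrow B hB rfl l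
  -- Clear the entry `(k, j)`; adding row `k` to row `i` then keeps the entry `(i, j)`.
  set c := -(B k j / B i j)
  have hB1 := hB.trans (.rowOp B hk c)
  have hB2 := hB1.trans (.rowOp _ hk.symm 1)
  have hc : B k j + c * B i j = 0 := by
    have := Int.ediv_mul_cancel (hcol B hB rfl k)
    simp only [c]; linarith
  have h := hrow _ hB2 (by
    rw [transvection_mul_apply_same, transvection_mul_apply_same,
      transvection_mul_apply_of_ne _ _ _ _ hk.symm, hc]; simp) l
  rw [transvection_mul_apply_same, transvection_mul_apply_same,
      transvection_mul_apply_of_ne _ _ _ _ hk.symm, one_mul] at h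
  have h1 := hrow B hB rfl l
  have h2 := (Int.dvd_add_right h1).1 h
  exact (Int.dvd_add_left (Dvd.dvd.mul_left h1 c)).1 h2

/-- The bijection that singles out the index `0`. -/
def sumUnitFinEquiv (m : ℕ) : Unit ⊕ Fin m ≃ Fin (m + 1) where
  toFun := Sum.elim (fun _ => 0) Fin.succ
  invFun := Fin.cases (Sum.inl ()) Sum.inr
  left_inv := by rintro (_ | i) <;> simp
  right_inv := by intro i; cases i using Fin.cases <;> simp

theorem exists_unimodularEquiv_diagonal_int (m : ℕ) (A : Matrix (Fin m) (Fin m) ℤ) :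
    ∃ d : Fin m → ℤ, (∀ i j, i ≤ j → d i ∣ d j) ∧ UnimodularEquiv A (diagonal d) := by
  induction m with
  | zero => exact ⟨0, fun i => i.elim0, by convert UnimodularEquiv.refl A; ext i; exact i.elim0⟩
  | succ m ih =>
    rcases eq_or_ne A 0 with rfl | hA
    · exact ⟨0, by simp, by rw [diagonal_zero']; exact .refl 0⟩
    obtain ⟨B, hB, i, j, hij⟩ := exists_unimodularEquiv_pivot hA
    let e := sumUnitFinEquiv m
    let B' := (B.submatrix (Equiv.swap 0 i) (Equiv.swap 0 j)).submatrix e e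
    set b := B i j
    have hb : ∀ x y, b ∣ B' x y := fun x y => hij _ _
    have hb0 : B' (.inl ()) (.inl ()) = b := by simp [B', e, sumUnitFinEquiv, b]
    choose q hq using hb
    let r : Matrix Unit (Fin m) ℤ := of fun _ k => q (.inl ()) (.inr k)
    let c : Matrix (Fin m) Unit ℤ := of fun k _ => q (.inr k) (.inl ())
    let D : Matrix (Fin m) (Fin m) ℤ := of fun k l => B' (.inr k) (.inr l) - b * (c * r) k l
    let M : Matrix (Unit ⊕ Fin m) (Unit ⊕ Fin m) ℤ := fromBlocks (diagonal fun _ => b) 0 0 D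
    have hM : UnimodularEquiv M B' := by
      refine ⟨fromBlocks 1 0 c 1, fromBlocks 1 r 0 1, by simp, by simp, ?_⟩
      simp only [M, fromBlocks_multiply]
      ext x y
      rcases x with x | x <;> rcases y with y | y
      · simp [hb0]
      · simp [r, hq (.inl ()) (.inr y), Matrix.mul_apply]
      · simp [c, hq (.inr x) (.inl ()), Matrix.mul_apply, mul_comm]
      · simp [D, Matrix.mul_apply]
        ring
    have hD : ∀ x y, b ∣ D x y := fun x y =>
      dvd_sub (hij _ _) (dvd_mul_right _ _)
    obtain ⟨d, hd, hDd⟩ := ih D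
    have hbd : ∀ k, b ∣ d k := fun k => by simpa using hDd.dvd hD k k
    have hM' : UnimodularEquiv M (diagonal (Sum.elim (fun _ => b) d)) := by
      obtain ⟨P, Q, hP, hQ, h⟩ := hDd
      refine ⟨fromBlocks 1 0 0 P, fromBlocks 1 0 0 Q, by simpa using hP, by simpa using hQ, ?_⟩
      simp [M, fromBlocks_multiply, h, fromBlocks_diagonal]
    refine ⟨Sum.elim (fun _ => b) d ∘ e.symm, ?_, ?_⟩
    · intro x y hxy
      cases x using Fin.cases with
      | zero =>
        cases y using Fin.cases with
        | zero => rfl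
        | succ y => simpa [e, sumUnitFinEquiv] using hbd y
      | succ x =>
        cases y using Fin.cases with
        | zero => simp at hxy
        | succ y => simpa [e, sumUnitFinEquiv] using hd x y (by simpa using hxy)
    · have h := (hM.symm.trans hM').submatrix e.symm
      have h' := hB.trans (.submatrix_perm B (Equiv.swap 0 i) (Equiv.swap 0 j))
      refine h'.trans ?_
      rw [submatrix_diagonal_equiv] at h
      simpa [B', Function.comp_assoc] using h

/-- Every square integer matrix is unimodularly equivalent to a diagonal matrix with nonnegative
entries, each of which divides the next one. -/
theorem exists_unimodularEquiv_diagonal (m : ℕ) (A : Matrix (Fin m) (Fin m) ℤ) :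
    ∃ d : Fin m → ℕ, (∀ i j, i ≤ j → d i ∣ d j) ∧
      UnimodularEquiv A (diagonal fun i => (d i : ℤ)) := by
  obtain ⟨d, hd, h⟩ := exists_unimodularEquiv_diagonal_int m A
  refine ⟨fun i => (d i).natAbs, fun i j hij => Int.natAbs_dvd_natAbs.2 (hd i j hij), ?_⟩
  refine h.trans ?_
  convert UnimodularEquiv.mul_left (P := diagonal fun i => if d i < 0 then (-1 : ℤ) else 1) ?_ _
  · rw [diagonal_mul_diagonal]
    congr 1
    ext i
    dsimp only
    split_ifs <;> omega
  · rw [det_diagonal]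
    exact IsUnit.prod_iff.2 fun i _ => by split_ifs <;> simp

end Matrix

theorem List.exists_eq_replicate_one_append {l : List ℕ} (hl : l.Pairwise (· ∣ ·)) :
    ∃ k s, l = List.replicate k 1 ++ s ∧ 1 ∉ s ∧ s.IsChain (· ∣ ·) := by
  induction l with
  | nil => exact ⟨0, [], by simp⟩
  | cons a l ih =>
    obtain ⟨k, s, rfl, h1, hs⟩ := ih hl.of_cons
    rcases eq_or_ne a 1 with rfl | ha
    · exact ⟨k + 1, s, by simp [List.replicate_succ], h1, hs⟩
    · refine ⟨0, _, rfl, ?_, hl.isChain⟩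
      intro hmem
      rcases List.mem_cons.1 hmem with h | h
      · exact ha h.symm
      · exact ha (Nat.dvd_one.1 (List.rel_of_pairwise_cons hl h))

theorem exists_hasInvariantFactors {n : Type*} [Fintype n] (A : Matrix n n ℤ) :
    ∃ s, HasInvariantFactors A s := by
  classical
  let e := Fintype.equivFin n
  obtain ⟨d, hd, h⟩ := Matrix.exists_unimodularEquiv_diagonal _ (A.submatrix e.symm e.symm)
  have hpw : (List.ofFn d).Pairwise (· ∣ ·) :=
    List.pairwise_ofFn.2 fun i j hij => hd i j hij.le
  obtain ⟨k, s, hks, h1, hs⟩ := List.exists_eq_replicate_one_append hpw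
  have hlen : (List.replicate k 1 ++ s).length = Fintype.card n := by
    rw [← hks, List.length_ofFn]
  obtain ⟨P, Q, hP, hQ, hPQ⟩ := h.submatrix e
  refine ⟨s, h1, hs, k, e.trans (finCongr hlen.symm), P, Q, ?_, ?_, ?_⟩
  · convert hP
  · convert hQ
  · rw [Matrix.submatrix_diagonal_equiv] at hPQ
    simp only [Matrix.submatrix_submatrix, Equiv.symm_comp_self, Matrix.submatrix_id_id] at hPQ
    rw [hPQ]
    congr 1
    · ext i
      simp [← hks]

/-- A divisor chain is determined by its length and by the numbers `∏ gcd (dᵢ, m)`. -/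
theorem List.eq_of_prod_gcd_eq {l l' : List ℕ} (hl : l.Pairwise (· ∣ ·))
    (hl' : l'.Pairwise (· ∣ ·)) (hlen : l.length = l'.length)
    (h : ∀ m, 0 < m → (l.map (Nat.gcd · m)).prod = (l'.map (Nat.gcd · m)).prod) : l = l' := by
  -- If the first entry `a` of `l` divides all its entries, the product for a divisor `m` of `a` is
  -- `m ^ length`, which forces `m` to divide all entries of `l'`.
  have key : ∀ {a b : ℕ} {t t' : List ℕ}, (a :: t).Pairwise (· ∣ ·) → t.length = t'.length →
      (∀ m, 0 < m → ((a :: t).map (Nat.gcd · m)).prod = ((b :: t').map (Nat.gcd · m)).prod) →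
      ∀ m, 0 < m → m ∣ a → m ∣ b := by
    intro a b t t' ht hlen h m hm hma
    have h1 : (a :: t).map (Nat.gcd · m) = List.replicate (t.length + 1) m := by
      refine List.eq_replicate_iff.2 ⟨by simp, fun x hx => ?_⟩
      obtain ⟨y, hy, rfl⟩ := List.mem_map.1 hx
      refine Nat.gcd_eq_right (hma.trans ?_)
      rcases List.mem_cons.1 hy with rfl | hy
      · rfl
      · exact List.rel_of_pairwise_cons ht hy
    have h2 := h m hm
    rw [h1, List.prod_replicate, List.map_cons, List.prod_cons, pow_succ', hlen] at h2
    have h3 : (t'.map (Nat.gcd · m)).prod ≤ m ^ t'.length := by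
      simpa using List.prod_le_pow_card (t'.map (Nat.gcd · m)) m (by
        intro x hx
        obtain ⟨y, -, rfl⟩ := List.mem_map.1 hx
        exact Nat.gcd_le_right _ hm)
    have h4 : m ≤ Nat.gcd b m := by
      refine Nat.le_of_mul_le_mul_right (c := m ^ t'.length) ?_ (by positivity)
      rw [h2]
      exact Nat.mul_le_mul_left _ h3
    exact Nat.gcd_eq_right_iff_dvd.1 (le_antisymm (Nat.gcd_le_right _ hm) h4)
  induction l generalizing l' with
  | nil => exact (List.length_eq_zero_iff.1 hlen.symm).symm
  | cons a t ih =>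
    obtain _ | ⟨b, t'⟩ := l'
    · simp at hlen
    have hlen' : t.length = t'.length := by simpa using hlen
    have hab := key hl hlen' h
    have hba := key hl' hlen'.symm fun m hm => (h m hm).symm
    have : a = b := by
      rcases Nat.eq_zero_or_pos a with rfl | ha
      · by_contra hb
        have := Nat.le_of_dvd (by omega) (hab (b + 1) (by omega) (dvd_zero _))
        omega
      rcases Nat.eq_zero_or_pos b with rfl | hb
      · have := Nat.le_of_dvd ha (hba (a + 1) (by omega) (dvd_zero _))
        omega
      · exact Nat.dvd_antisymm (hab a ha dvd_rfl) (hba b hb dvd_rfl)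
    subst this
    rw [ih hl.of_cons hl'.of_cons hlen' fun m hm => ?_]
    have := h m hm
    simp only [List.map_cons, List.prod_cons] at this
    exact Nat.eq_of_mul_eq_mul_left (Nat.gcd_pos_of_pos_right _ hm) this

theorem ZMod.card_mul_eq_zero (m : ℕ) [NeZero m] (d : ℕ) :
    Nat.card {x : ZMod m // (d : ZMod m) * x = 0} = d.gcd m := by
  have h := IsAddCyclic.card_nsmulAddMonoidHom_ker (ZMod m) d
  rw [Nat.card_zmod, Nat.gcd_comm] at h
  rw [← h]
  exact Nat.card_congr (Equiv.subtypeEquivRight fun x => by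
    simp [AddMonoidHom.mem_ker, nsmul_eq_mul])

/-- The invariant factors count the solutions of the homogeneous system modulo every `m`. -/
theorem HasInvariantFactors.card_ker {n : Type*} [Fintype n] {A : Matrix n n ℤ} {s : List ℕ}
    (h : HasInvariantFactors A s) (m : ℕ) [NeZero m] :
    Nat.card {x : n → ZMod m // (A.map (Int.castRingHom (ZMod m))).mulVec x = 0} =
      (s.map (Nat.gcd · m)).prod := by
  classical
  obtain ⟨-, -, k, h⟩ := h
  generalize hl : List.replicate k 1 ++ s = l at h
  obtain ⟨σ, P, Q, hP, hQ, hPQ⟩ := h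
  let f := Int.castRingHom (ZMod m)
  replace hP : IsUnit (P.map f).det := by
    have := hP.map f
    rw [RingHom.map_det] at this
    convert this
    rfl
  replace hQ : IsUnit (Q.map f).det := by
    have := hQ.map f
    rw [RingHom.map_det] at this
    convert this
    rfl
  replace hPQ : P.map f * A.map f * Q.map f =
      Matrix.diagonal fun i => ((l.get (σ i) : ℕ) : ZMod m) := by
    have := congrArg (fun M : Matrix n n ℤ => M.map f) hPQ
    simp only [Matrix.map_mul] at this
    rw [this]
    ext i j
    by_cases hij : i = j <;> simp [hij]
  have hQu : IsUnit (Q.map f) := (Matrix.isUnit_iff_isUnit_det _).2 hQ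
  have hPinj : Function.Injective (P.map f).mulVec :=
    Matrix.mulVec_injective_of_isUnit ((Matrix.isUnit_iff_isUnit_det _).2 hP)
  have hQbij : Function.Bijective (Q.map f).mulVec :=
    ⟨Matrix.mulVec_injective_of_isUnit hQu, Matrix.mulVec_surjective_iff_isUnit.2 hQu⟩
  have h1 : Nat.card {y : n → ZMod m //
      (Matrix.diagonal fun i => ((l.get (σ i) : ℕ) : ZMod m)).mulVec y = 0} =
      Nat.card {x : n → ZMod m // (A.map f).mulVec x = 0} := by
    refine Nat.card_congr ((Equiv.ofBijective _ hQbij).subtypeEquiv fun y => ?_)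
    rw [← hPQ, ← Matrix.mulVec_mulVec, ← Matrix.mulVec_mulVec, Equiv.ofBijective_apply]
    exact hPinj.eq_iff' (Matrix.mulVec_zero _)
  have h2 : Nat.card {y : n → ZMod m //
      (Matrix.diagonal fun i => ((l.get (σ i) : ℕ) : ZMod m)).mulVec y = 0} =
      ∏ i : n, (l.get (σ i)).gcd m := by
    simp only [← ZMod.card_mul_eq_zero]
    rw [← Nat.card_pi]
    refine Nat.card_congr (Equiv.trans (Equiv.subtypeEquivRight fun y => ?_)
      (Equiv.subtypePiEquivPi (p := fun i x => ((l.get (σ i) : ℕ) : ZMod m) * x = 0)))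
    simp [funext_iff, Matrix.mulVec_diagonal]
  rw [← h1, h2, Equiv.prod_comp σ fun i => (l.get i).gcd m]
  have h3 : (l.map (Nat.gcd · m)).prod = ∏ i, (l.get i).gcd m := by
    rw [← List.prod_ofFn]
    conv_lhs => rw [← List.ofFn_get l, List.map_ofFn]
    rfl
  rw [← h3, ← hl]
  simp

/-- Two matrices of possibly different sizes have the same invariant factors if the corresponding
homogeneous systems have equally many solutions modulo every `m`. -/
theorem HasInvariantFactors.of_card_ker_eq {n p : Type*} [Fintype n] [Fintype p]
    {A : Matrix n n ℤ} {B : Matrix p p ℤ} {s : List ℕ} (hs : HasInvariantFactors A s)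
    (h : ∀ m : ℕ, 0 < m →
      Nat.card {x : n → ZMod m // (A.map (Int.castRingHom (ZMod m))).mulVec x = 0} =
      Nat.card {x : p → ZMod m // (B.map (Int.castRingHom (ZMod m))).mulVec x = 0}) :
    HasInvariantFactors B s := by
  obtain ⟨t, ht⟩ := exists_hasInvariantFactors B
  suffices s = t by rwa [this]
  have hpad : ∀ (k : ℕ) {s : List ℕ}, s.IsChain (· ∣ ·) →
      (List.replicate k 1 ++ s).Pairwise (· ∣ ·) := fun k s hs => by
    rw [List.pairwise_append]
    exact ⟨by simp [List.pairwise_replicate], hs.pairwise, fun a ha b _ => by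
      rw [List.eq_of_mem_replicate ha]; exact one_dvd b⟩
  have heq := List.eq_of_prod_gcd_eq (hpad t.length hs.2.1) (hpad s.length ht.2.1)
    (by simp [add_comm]) fun m hm => by
      have : NeZero m := ⟨hm.ne'⟩
      have := h m hm
      rw [hs.card_ker, ht.card_ker] at this
      simpa using this
  have hfilter : ∀ (k : ℕ) {s : List ℕ}, 1 ∉ s →
      (List.replicate k 1 ++ s).filter (· ≠ 1) = s := fun k s hs => by
    rw [List.filter_append, List.filter_replicate]
    simp only [ne_eq, not_true_eq_false, decide_false, Bool.false_eq_true, if_false,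
      List.nil_append, List.filter_eq_self, decide_eq_true_eq]
    rintro a ha rfl
    exact hs ha
  rw [← hfilter t.length hs.1, heq, hfilter s.length ht.1]

/-! ### Dual pairs of integer matrices -/

namespace Matrix

variable {a c n K : Type*} [Fintype a] [Fintype c] [Fintype n] [DecidableEq a] [DecidableEq c]
  [DecidableEq n] [CommRing K]

/-- If the rows of `A` and of `C` are orthogonal and both matrices have a right inverse, then
`0 → Kᵃ → Kⁿ → Kᶜ → 0` with maps `Aᵀ` and `C` is split exact as soon as the dimensions fit:
the two splittings assemble to a square matrix with a one-sided inverse. -/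
theorem exists_splitting {A : Matrix a n K} {C : Matrix c n K}
    (hA : Function.Surjective A.mulVec) (hC : Function.Surjective C.mulVec) (hAC : A * Cᵀ = 0)
    (hcard : Fintype.card a + Fintype.card c = Fintype.card n) :
    ∃ (R : Matrix n a K) (S : Matrix n c K), A * R = 1 ∧ C * S = 1 ∧ Aᵀ * Rᵀ + S * C = 1 := by
  obtain ⟨R, hR⟩ := mulVec_surjective_iff_exists_right_inverse.1 hA
  obtain ⟨S, hS⟩ := mulVec_surjective_iff_exists_right_inverse.1 hC
  have hCA : C * Aᵀ = 0 := by simpa using congrArg transpose hAC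
  have hRA : Rᵀ * Aᵀ = 1 := by rw [← transpose_mul, hR, transpose_one]
  have hCS : C * (S - Aᵀ * (Rᵀ * S)) = 1 := by
    rw [Matrix.mul_sub, ← Matrix.mul_assoc C, hCA, Matrix.zero_mul, hS, sub_zero]
  have hRS : Rᵀ * (S - Aᵀ * (Rᵀ * S)) = 0 := by
    rw [Matrix.mul_sub, ← Matrix.mul_assoc Rᵀ, hRA, Matrix.one_mul, sub_self]
  refine ⟨R, S - Aᵀ * (Rᵀ * S), hR, hCS, ?_⟩
  rw [← fromCols_mul_fromRows, 
    fromCols_mul_fromRows_eq_one_comm (Fintype.equivOfCardEq (by simpa using hcard.symm)),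
    fromRows_mul_fromCols, hRA, hRS, hCA, hCS, fromBlocks_one]

/-- The kernels of `A Aᵀ` and `C Cᵀ` are both isomorphic to the intersection of the images of
`Aᵀ` and `Cᵀ`. -/
theorem card_ker_mul_transpose_eq {A : Matrix a n K} {C : Matrix c n K} {R : Matrix n a K}
    {S : Matrix n c K} (hR : A * R = 1) (hS : C * S = 1) (hAC : A * Cᵀ = 0)
    (hRS : Aᵀ * Rᵀ + S * C = 1) :
    Nat.card {y : a → K // (A * Aᵀ).mulVec y = 0} =
      Nat.card {z : c → K // (C * Cᵀ).mulVec z = 0} := by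
  have hCA : C * Aᵀ = 0 := by simpa using congrArg transpose hAC
  have hRA : Rᵀ * Aᵀ = 1 := by rw [← transpose_mul, hR, transpose_one]
  have hSC : Sᵀ * Cᵀ = 1 := by rw [← transpose_mul, hS, transpose_one]
  have hRS' : R * A + Cᵀ * Sᵀ = 1 := by simpa using congrArg transpose hRS
  have h1 : ∀ y : a → K, (A * Aᵀ).mulVec y = 0 →
      Cᵀ.mulVec ((Sᵀ * Aᵀ).mulVec y) = Aᵀ.mulVec y := fun y hy => by
    have : (R * A + Cᵀ * Sᵀ).mulVec (Aᵀ.mulVec y) = Aᵀ.mulVec y := by rw [hRS', one_mulVec]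
    rw [add_mulVec, mulVec_mulVec, Matrix.mul_assoc, ← mulVec_mulVec, hy, mulVec_zero,
      zero_add] at this
    simpa [mulVec_mulVec, Matrix.mul_assoc] using this
  have h2 : ∀ z : c → K, (C * Cᵀ).mulVec z = 0 →
      Aᵀ.mulVec ((Rᵀ * Cᵀ).mulVec z) = Cᵀ.mulVec z := fun z hz => by
    have : (Aᵀ * Rᵀ + S * C).mulVec (Cᵀ.mulVec z) = Cᵀ.mulVec z := by rw [hRS, one_mulVec]
    rw [add_mulVec, mulVec_mulVec _ (S * C), Matrix.mul_assoc S, ← mulVec_mulVec _ S, hz,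
      mulVec_zero, add_zero] at this
    simpa [mulVec_mulVec, Matrix.mul_assoc] using this
  refine Nat.card_congr ⟨fun y => ⟨(Sᵀ * Aᵀ).mulVec y, ?_⟩, fun z => ⟨(Rᵀ * Cᵀ).mulVec z, ?_⟩,
    fun y => Subtype.ext ?_, fun z => Subtype.ext ?_⟩
  · rw [← mulVec_mulVec _ C, h1 y y.2, mulVec_mulVec, hCA, zero_mulVec]
  · rw [← mulVec_mulVec _ A, h2 z z.2, mulVec_mulVec, hAC, zero_mulVec]
  · dsimp only
    rw [← mulVec_mulVec _ Rᵀ, h1 y y.2, mulVec_mulVec, hRA, one_mulVec]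
  · dsimp only
    rw [← mulVec_mulVec _ Sᵀ, h2 z z.2, mulVec_mulVec, hSC, one_mulVec]

end Matrix

open Matrix in
theorem exists_hasInvariantFactors_mul_transpose {a c n : Type*} [Fintype a] [Fintype c]
    [Fintype n] [DecidableEq a] [DecidableEq c] [DecidableEq n]
    {A : Matrix a n ℤ} {C : Matrix c n ℤ} {R : Matrix n a ℤ}
    {S : Matrix n c ℤ} (hR : A * R = 1) (hS : C * S = 1) (hAC : A * Cᵀ = 0)
    (hRS : Aᵀ * Rᵀ + S * C = 1) :
    ∃ s, HasInvariantFactors (A * Aᵀ) s ∧ HasInvariantFactors (C * Cᵀ) s := by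
  obtain ⟨s, hs⟩ := exists_hasInvariantFactors (A * Aᵀ)
  refine ⟨s, hs, hs.of_card_ker_eq fun m _ => ?_⟩
  let f := Int.castRingHom (ZMod m)
  have h1 : (A.map f) * (R.map f) = 1 := by rw [← Matrix.map_mul, hR]; simp
  have h2 : (C.map f) * (S.map f) = 1 := by rw [← Matrix.map_mul, hS]; simp
  have h3 : (A.map f) * (C.map f)ᵀ = 0 := by
    rw [← Matrix.transpose_map, ← Matrix.map_mul, hAC]; simp
  have h4 : (A.map f)ᵀ * (R.map f)ᵀ + (S.map f) * (C.map f) = 1 := by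
    have := congrArg (fun M : Matrix n n ℤ => M.map f) hRS
    simpa [Matrix.map_add, Matrix.map_mul, Matrix.transpose_map] using this
  have h5 := card_ker_mul_transpose_eq h1 h2 h3 h4
  rwa [← Matrix.transpose_map, ← Matrix.map_mul, ← Matrix.transpose_map, ← Matrix.map_mul] at h5

/-! ### Signed incidence matrices -/

namespace Matrix

variable {X E : Type*}

open Classical in
/-- The signed incidence matrix of the directed multigraph with vertex set `X` in which `e : E` is
an arrow from `s e` to `t e`. -/
def signedIncidence (s t : E → X) : Matrix X E ℤ :=
  of fun x e => (if t e = x then 1 else 0) - (if s e = x then 1 else 0)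

theorem sum_signedIncidence [Fintype X] (s t : E → X) (e : E) :
    ∑ x, signedIncidence s t x e = 0 := by
  classical
  simp [signedIncidence, Finset.sum_sub_distrib]

theorem sum_signedIncidence_mulVec [Fintype X] [Fintype E] (s t : E → X) (z : E → ℤ) :
    ∑ x, (signedIncidence s t).mulVec z x = 0 := by
  simp only [mulVec, dotProduct]
  rw [Finset.sum_comm]
  simp [← Finset.sum_mul, sum_signedIncidence]

theorem transpose_submatrix_val_mulVec [Fintype X] (M : Matrix X E ℤ) (p : X → Prop)
    [Fintype {x // p x}] (w : {x // p x} → ℤ) :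
    ∃ z, (M.submatrix (Subtype.val : {x // p x} → X) id)ᵀ.mulVec w = Mᵀ.mulVec z := by
  classical
  refine ⟨fun x => if h : p x then w ⟨x, h⟩ else 0, ?_⟩
  ext e
  simp only [mulVec, dotProduct, transpose_apply, submatrix_apply, id]
  rw [← Fintype.sum_subtype_add_sum_subtype p]
  have h1 : ∀ x : {x // p x}, p x := fun x => x.2
  have h2 : ∀ x : {x // ¬ p x}, ¬ p x := fun x => x.2
  simp only [h1, h2, dite_true, dite_false, mul_zero, Finset.sum_const_zero, add_zero]
  convert! rfl

theorem sum_mul_transpose_signedIncidence [Fintype X] [Fintype E] (s t : E → X) (x : X) :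
    ∑ y, (signedIncidence s t * (signedIncidence s t)ᵀ) x y = 0 := by
  simp only [mul_apply, transpose_apply]
  rw [Finset.sum_comm]
  simp [← Finset.mul_sum, sum_signedIncidence]

/-- Along a walk from `x` to the root, the columns of the arrows, up to sign, add up to the
basis vector of `x`. -/
theorem signedIncidence_submatrix_mulVec_surjective [Finite X] [Fintype E] {s t : E → X} {x₀ : X}
    (h : ∀ x, Relation.EqvGen (fun x y => ∃ e, s e = x ∧ t e = y) x x₀) :
    Function.Surjective
      ((signedIncidence s t).submatrix (Subtype.val : {x // x ≠ x₀} → X) id).mulVec := by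
  classical
  have := Fintype.ofFinite X
  set M := (signedIncidence s t).submatrix (Subtype.val : {x // x ≠ x₀} → X) id
  let g : X → {x // x ≠ x₀} → ℤ := fun x y => if x = y then 1 else 0
  have hstep : ∀ x y, Relation.EqvGen (fun x y => ∃ e, s e = x ∧ t e = y) x y →
      g x - g y ∈ LinearMap.range M.mulVecLin := by
    intro x y hxy
    induction hxy with
    | rel x y h =>
      obtain ⟨e, rfl, rfl⟩ := h
      refine ⟨-Pi.single e 1, ?_⟩
      ext y
      simp [M, g, signedIncidence, mulVec_neg]
    | refl x => simp
    | symm x y _ ih => rw [← neg_sub]; exact neg_mem ih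
    | trans x y z _ _ ih ih' => rw [← sub_add_sub_cancel _ (g y)]; exact add_mem ih ih'
  have h0 : g x₀ = 0 := by
    ext y
    simp [g, y.2.symm]
  change Function.Surjective M.mulVecLin
  rw [← LinearMap.range_eq_top, eq_top_iff]
  rintro z -
  have : z = ∑ y : {x // x ≠ x₀}, z y • g y := by
    ext y
    simp [g, Subtype.val_inj]
  rw [this]
  refine sum_mem fun y _ => Submodule.smul_mem _ _ ?_
  simpa [h0] using hstep y x₀ (h y)

end Matrix

/-! ### The Laplacian and the Jacobian -/

namespace Graph

open Matrix

variable {α β : Type*} {G : Graph α β}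

theorem Dart.isLink_iff (d : G.Dart) (x y : V(G)) :
    G.IsLink (d.edge : β) x y ↔ (d.src = x ∧ d.tgt = y) ∨ (d.src = y ∧ d.tgt = x) := by
  rw [d.isLink.isLink_iff]
  simp only [Subtype.val_inj]

theorem Dart.src_ne_tgt [G.Loopless] (d : G.Dart) : d.src ≠ d.tgt := fun h =>
  d.isLink.ne (congrArg Subtype.val h)

namespace Orientation

variable (o : G.Orientation)

theorem isLink_iff (e : E(G)) (x y : V(G)) : G.IsLink (e : β) x y ↔
    ((o.dart e).src = x ∧ (o.dart e).tgt = y) ∨ ((o.dart e).src = y ∧ (o.dart e).tgt = x) := by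
  rw [← (o.dart e).isLink_iff, o.edge_dart]

theorem inc_iff (e : E(G)) (x : V(G)) :
    G.Inc (e : β) x ↔ (o.dart e).src = x ∨ (o.dart e).tgt = x := by
  have h := (o.dart e).isLink
  rw [o.edge_dart] at h
  constructor
  · intro hx
    rcases hx.eq_or_eq_of_isLink h with hx | hx
    · exact .inl (Subtype.ext hx.symm)
    · exact .inr (Subtype.ext hx.symm)
  · rintro (rfl | rfl)
    exacts [h.inc_left, h.inc_right]

/-- The signed incidence matrix of an oriented graph, the matrix of the boundary map from edges
to vertices. -/
def incMatrix : Matrix V(G) E(G) ℤ :=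
  signedIncidence (fun e => (o.dart e).src) (fun e => (o.dart e).tgt)

/-- The signed incidence matrix without the row of the vertex `v`. -/
def reducedIncMatrix (v : V(G)) : Matrix {x : V(G) // x ≠ v} E(G) ℤ :=
  o.incMatrix.submatrix Subtype.val id

theorem eq_dart_or_eq_rev (d : G.Dart) : d = o.dart d.edge ∨ d = G.rev (o.dart d.edge) := by
  rcases (o.isLink_iff d.edge d.src d.tgt).1 d.isLink with ⟨h1, h2⟩ | ⟨h1, h2⟩
  · exact .inl (Dart.ext (o.edge_dart _).symm h1.symm h2.symm)
  · exact .inr (Dart.ext (o.edge_dart _).symm h2.symm h1.symm)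

/-- An edge of a loopless graph carries exactly two darts. -/
def edgeSumEquivDart [G.Loopless] : E(G) ⊕ E(G) ≃ G.Dart :=
  Equiv.ofBijective (Sum.elim o.dart fun e => G.rev (o.dart e)) <| by
    have hrev : ∀ d : G.Dart, (G.rev d).edge = d.edge := fun _ => rfl
    have hne : ∀ e e', o.dart e ≠ G.rev (o.dart e') := fun e e' h => by
      have he : e = e' := by
        rw [← o.edge_dart e, h, hrev, o.edge_dart]
      subst he
      exact (o.dart e).src_ne_tgt (congrArg Dart.src h)
    have hinj : ∀ e e', o.dart e = o.dart e' → e = e' := fun e e' h => by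
      rw [← o.edge_dart e, h, o.edge_dart]
    refine ⟨?_, fun d => ?_⟩
    · rintro (e | e) (e' | e') h
      · exact congrArg Sum.inl (hinj _ _ h)
      · exact (hne _ _ h).elim
      · exact (hne _ _ h.symm).elim
      · exact congrArg Sum.inr (hinj _ _ (G.rev.injective h))
    · rcases o.eq_dart_or_eq_rev d with h | h
      · exact ⟨.inl d.edge, h.symm⟩
      · exact ⟨.inr d.edge, h.symm⟩

theorem sum_dart [G.Loopless] [Fintype E(G)] [Fintype G.Dart] (φ : G.Dart → ℤ) :
    ∑ d, φ d = ∑ e, (φ (o.dart e) + φ (G.rev (o.dart e))) := by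
  rw [← o.edgeSumEquivDart.sum_comp, Fintype.sum_sum_type, Finset.sum_add_distrib]
  rfl

end Orientation

open Classical in
theorem ncard_setOf_eq_sum [Fintype E(G)] {p : β → Prop} (hp : ∀ e, p e → e ∈ E(G)) :
    ({e | p e}.ncard : ℤ) = ∑ e : E(G), if p e then 1 else 0 := by
  rw [Finset.sum_boole, ← Fintype.card_subtype, ← Nat.card_eq_fintype_card,
    ← Nat.card_coe_set_eq]
  congr 1
  exact Nat.card_congr ⟨fun e => ⟨⟨e, hp e e.2⟩, e.2⟩, fun e => ⟨e.1, e.2⟩,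
    fun _ => rfl, fun _ => rfl⟩

theorem laplacian_eq [Fintype E(G)] [G.Loopless] (o : G.Orientation) :
    G.laplacian = o.incMatrix * o.incMatrixᵀ := by
  classical
  ext x y
  have hadj : G.adjMatrix x y = ∑ e : E(G), if G.IsLink (e : β) x y then 1 else 0 :=
    ncard_setOf_eq_sum fun e h => h.edge_mem
  have hdeg : ((G.incidenceSet (x : α)).ncard : ℤ) = ∑ e : E(G), if G.Inc (e : β) x then 1 else 0 :=
    ncard_setOf_eq_sum fun e h => h.edge_mem
  simp only [laplacian, degreeMatrix, Matrix.sub_apply, diagonal_apply, hadj, hdeg, mul_apply,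
    transpose_apply, Orientation.incMatrix, signedIncidence, of_apply]
  rcases eq_or_ne x y with rfl | hxy
  · rw [if_pos rfl, ← Finset.sum_sub_distrib]
    refine Finset.sum_congr rfl fun e _ => ?_
    have hne := (o.dart e).src_ne_tgt
    simp only [o.isLink_iff, o.inc_iff]
    by_cases h1 : (o.dart e).src = x <;> by_cases h2 : (o.dart e).tgt = x
    · exact (hne (h1.trans h2.symm)).elim
    all_goals simp [h1, h2]
  · rw [if_neg hxy, zero_sub, ← Finset.sum_neg_distrib]
    refine Finset.sum_congr rfl fun e _ => ?_
    simp only [o.isLink_iff]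
    have h3 : (o.dart e).src = x → (o.dart e).src ≠ y := fun h => h ▸ hxy
    have h4 : (o.dart e).tgt = x → (o.dart e).tgt ≠ y := fun h => h ▸ hxy
    have h5 := (o.dart e).src_ne_tgt
    by_cases h1 : (o.dart e).src = x <;> by_cases h2 : (o.dart e).tgt = x
    · exact (h5 (h1.trans h2.symm)).elim
    · simp [h1, h2, hxy]
      split_ifs <;> rfl
    · simp [h1, h2, hxy]
    · simp [h1, h2]

theorem reducedLaplacian_eq [Fintype E(G)] [G.Loopless] (o : G.Orientation) (v : V(G)) :
    G.reducedLaplacian v = o.reducedIncMatrix v * (o.reducedIncMatrix v)ᵀ := by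
  rw [reducedLaplacian, laplacian_eq o]
  rfl

open Classical in
theorem lending_eq [Fintype V(G)] [Fintype E(G)] [G.Loopless] (o : G.Orientation) (v : V(G)) :
    G.lending v = (o.incMatrix * o.incMatrixᵀ).mulVec (-Pi.single v 1) := by
  -- The rows of the Laplacian add up to zero, so the degree of `v` is a sum of adjacencies.
  have h0 : ∑ w, G.laplacian v w = 0 := by
    rw [laplacian_eq o]
    exact sum_mul_transpose_signedIncidence _ _ v
  have hsymm : ∀ u, G.laplacian u v = G.laplacian v u := fun u => by
    rw [laplacian_eq o, ← Matrix.transpose_apply (_ * _), transpose_mul, transpose_transpose]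
  rw [← laplacian_eq]
  simp only [laplacian, degreeMatrix, Matrix.sub_apply, Finset.sum_sub_distrib, diagonal_apply,
    Finset.sum_ite_eq, Finset.mem_univ, if_true] at h0
  ext u
  have hu : (G.laplacian.mulVec (-Pi.single v 1)) u = - G.laplacian v u := by
    simp [mulVec_neg, hsymm]
  rw [hu]
  simp only [lending, smul_sub, Finset.sum_sub_distrib, Pi.sub_apply,
    Finset.sum_apply, Pi.smul_apply, Pi.single_apply, smul_eq_mul, mul_ite, mul_one, mul_zero,
    Finset.sum_ite_eq, Finset.mem_univ, if_true, laplacian, degreeMatrix, Matrix.sub_apply,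
    diagonal_apply]
  rcases eq_or_ne u v with rfl | h
  · simp; linarith
  · simp [h, h.symm]

theorem mem_principal_iff [Fintype V(G)] [Fintype E(G)] [G.Loopless] (o : G.Orientation)
    (D : G.Div) : D ∈ G.principal ↔ ∃ z, (o.incMatrix * o.incMatrixᵀ).mulVec z = D := by
  classical
  constructor
  · intro hD
    have hle : G.principal ≤ (o.incMatrix * o.incMatrixᵀ).mulVecLin.toAddMonoidHom.range := by
      refine (AddSubgroup.closure_le _).2 ?_
      rintro _ ⟨v, rfl⟩
      exact ⟨_, (lending_eq o v).symm⟩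
    exact hle hD
  · rintro ⟨z, rfl⟩
    have : (o.incMatrix * o.incMatrixᵀ).mulVec z = ∑ v, (-z v) • G.lending v := by
      simp only [lending_eq o, mulVec_neg, smul_neg, neg_smul, neg_neg]
      simp only [← mulVec_smul, ← mulVec_sum]
      congr 1
      ext u
      simp [Pi.single_apply]
    rw [this]
    exact sum_mem fun v _ => zsmul_mem (AddSubgroup.subset_closure (Set.mem_range_self v)) _

theorem IsConnected.reducedIncMatrix_mulVec_surjective (hG : G.IsConnected) [Fintype V(G)]
    [Fintype E(G)] (o : G.Orientation) (v : V(G)) :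
    Function.Surjective (o.reducedIncMatrix v).mulVec := by
  refine signedIncidence_submatrix_mulVec_surjective fun x => ?_
  suffices H : ∀ y, Relation.ReflTransGen G.Adj (x : α) y → ∀ hy : y ∈ V(G),
      Relation.EqvGen (fun x y => ∃ e, (o.dart e).src = x ∧ (o.dart e).tgt = y) x ⟨y, hy⟩ from
    H v (hG.2 x x.2 v v.2) v.2
  intro y hxy
  induction hxy with
  | refl => exact fun _ => .refl _
  | @tail b c _ hbc ih =>
    intro hc
    refine .trans _ _ _ (ih hbc.left_mem) ?_
    obtain ⟨e, he⟩ := hbc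
    rcases (o.isLink_iff ⟨e, he.edge_mem⟩ ⟨b, he.left_mem⟩ ⟨c, hc⟩).1 he with h | h
    · exact .rel _ _ ⟨_, h⟩
    · exact .symm _ _ (.rel _ _ ⟨_, h⟩)

/-- The homomorphism from the edge lattice to the Jacobian induced by the boundary map. -/
def Orientation.edgeToJac [Fintype V(G)] [Fintype E(G)] (o : G.Orientation) :
    (E(G) → ℤ) →+ G.Jac :=
  ((QuotientAddGroup.mk' G.principal).comp o.incMatrix.mulVecLin.toAddMonoidHom).codRestrict _
    fun z => sum_signedIncidence_mulVec _ _ z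

theorem Orientation.edgeToJac_eq_zero_iff [Fintype V(G)] [Fintype E(G)] [G.Loopless]
    (o : G.Orientation) (x : E(G) → ℤ) : o.edgeToJac x = 0 ↔
      ∃ z, (o.incMatrix * o.incMatrixᵀ).mulVec z = o.incMatrix.mulVec x := by
  rw [← mem_principal_iff, ← QuotientAddGroup.eq_zero_iff, ← Subtype.val_inj]
  rfl

theorem IsConnected.edgeToJac_surjective [Fintype V(G)] [Fintype E(G)]
    (hG : G.IsConnected) (o : G.Orientation) : Function.Surjective o.edgeToJac := by
  rintro ⟨q, hq⟩
  obtain ⟨D, rfl⟩ := QuotientAddGroup.mk_surjective q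
  replace hq : ∑ x, D x = 0 := hq
  obtain ⟨v⟩ := hG.1.to_subtype
  obtain ⟨x, hx⟩ := hG.reducedIncMatrix_mulVec_surjective o v fun y => D y
  have hx' : ∀ y, y ≠ v → o.incMatrix.mulVec x y = D y := fun y hy => congrFun hx ⟨y, hy⟩
  refine ⟨x, Subtype.ext (congrArg QuotientAddGroup.mk (?_ : o.incMatrix.mulVec x = D))⟩
  have h0 : ∑ y, o.incMatrix.mulVec x y = 0 := sum_signedIncidence_mulVec _ _ x
  classical
  rw [← Finset.add_sum_erase _ _ (Finset.mem_univ v)] at h0 hq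
  rw [Finset.sum_congr rfl fun y hy => hx' y (Finset.ne_of_mem_erase hy)] at h0
  ext y
  rcases eq_or_ne y v with rfl | hy
  · linarith
  · exact hx' y hy

end Graph

/-! ### The face cycle matrix -/

namespace Graph.RotationSystem

open Matrix

variable {α β : Type*} {G : Graph α β} (R : G.RotationSystem)

theorem faceOf_facePerm (d : G.Dart) : R.faceOf (R.facePerm d) = R.faceOf d :=
  Quotient.sound (s := Equiv.Perm.SameCycle.setoid R.cornerPerm)
    (Equiv.Perm.SameCycle.symm ⟨1, rfl⟩)

theorem src_facePerm (d : G.Dart) : (R.facePerm d).src = d.tgt :=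
  R.src_rot _

theorem faceOf_rot (d : G.Dart) : R.faceOf (R.rot d) = R.faceOf (G.rev d) :=
  R.faceOf_facePerm (G.rev d)

/-- The boundary walk of a face is closed: it enters every vertex as often as it leaves it. -/
theorem signedIncidence_face_mul_incMatrix_transpose [Fintype V(G)] [Fintype E(G)] [G.Loopless]
    (o : G.Orientation) :
    signedIncidence (fun e => R.faceOf (G.rev (o.dart e))) (fun e => R.faceOf (o.dart e)) *
      o.incMatrixᵀ = 0 := by
  classical
  have := Fintype.ofFinite G.Dart
  ext f x
  have h := o.sum_dart fun d => (if R.faceOf d = f then (1 : ℤ) else 0) *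
    ((if d.tgt = x then 1 else 0) - (if d.src = x then 1 else 0))
  have h0 : ∑ d : G.Dart, (if R.faceOf d = f then (1 : ℤ) else 0) *
      ((if d.tgt = x then 1 else 0) - (if d.src = x then 1 else 0)) = 0 := by
    simp only [mul_sub, Finset.sum_sub_distrib]
    rw [sub_eq_zero, ← Equiv.sum_comp R.facePerm fun d => (if R.faceOf d = f then (1 : ℤ) else 0) *
      (if d.src = x then 1 else 0)]
    simp only [R.faceOf_facePerm, R.src_facePerm]
  rw [h0] at h
  simp only [mul_apply, transpose_apply, Orientation.incMatrix, signedIncidence, of_apply,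
    Matrix.zero_apply]
  refine Eq.trans (Finset.sum_congr rfl fun e _ => ?_) h.symm
  have h1 : (G.rev (o.dart e)).tgt = (o.dart e).src := rfl
  have h2 : (G.rev (o.dart e)).src = (o.dart e).tgt := rfl
  rw [h1, h2]
  split_ifs <;> rfl

/-- The dual graph of a connected graph is connected: the darts around a vertex lie on consecutive
neighbouring faces, and the two darts of an edge lie on neighbouring faces. -/
theorem eqvGen_face [Finite V(G)] [Finite E(G)] (hG : G.IsConnected) (o : G.Orientation)
    (f f' : R.Face) : Relation.EqvGen (fun f f' => ∃ e, R.faceOf (G.rev (o.dart e)) = f ∧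
      R.faceOf (o.dart e) = f') f f' := by
  set r : R.Face → R.Face → Prop := fun f f' => ∃ e, R.faceOf (G.rev (o.dart e)) = f ∧
      R.faceOf (o.dart e) = f'
  have hrev : ∀ d, Relation.EqvGen r (R.faceOf d) (R.faceOf (G.rev d)) := by
    intro d
    rcases o.eq_dart_or_eq_rev d with h | h
    · rw [h]
      exact .symm _ _ (.rel _ _ ⟨_, rfl, rfl⟩)
    · rw [h]
      exact .rel _ _ ⟨_, rfl, rfl⟩
  have hrot : ∀ d d' : G.Dart, d.src = d'.src →
      Relation.EqvGen r (R.faceOf d) (R.faceOf d') := by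
    intro d d' h
    obtain ⟨i, -, hi⟩ := (R.sameCycle d d' h).exists_pow_eq'
    rw [← hi]
    clear hi
    induction i with
    | zero => exact .refl _
    | succ i ih =>
      rw [pow_succ', Equiv.Perm.mul_apply, R.faceOf_rot]
      exact .trans _ _ _ ih (hrev _)
  have hdart : ∀ x y, Relation.ReflTransGen G.Adj x y → ∀ d d' : G.Dart, d.src = x → d'.src = y →
      Relation.EqvGen r (R.faceOf d) (R.faceOf d') := by
    intro x y hxy
    induction hxy with
    | refl => exact fun d d' h h' => hrot d d' (Subtype.ext (h.trans h'.symm))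
    | @tail b c _ hbc ih =>
      intro d d' h h'
      obtain ⟨e, he⟩ := hbc
      let δ : G.Dart := ⟨⟨e, he.edge_mem⟩, ⟨b, he.left_mem⟩, ⟨c, he.right_mem⟩, he⟩
      exact .trans _ _ _ (ih d δ h rfl) (.trans _ _ _ (hrev δ) (hrot _ d' (Subtype.ext h'.symm)))
  -- A connected graph with an isolated vertex has no other vertex.
  have hiso : ∀ (w : {v : V(G) // ∀ e, ¬ G.Inc e (v : α)}) (x : V(G)), w.1 = x := by
    intro w x
    rcases Relation.ReflTransGen.cases_head (hG.2 w.1 w.1.2 x x.2) with h | ⟨y, ⟨e, he⟩, -⟩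
    · exact Subtype.ext h
    · exact (w.2 e he.inc_left).elim
  have hdart_iso : ∀ (d : G.Dart) (w : {v : V(G) // ∀ e, ¬ G.Inc e (v : α)}), False := by
    intro d w
    have h := d.isLink.inc_left
    rw [← hiso w d.src] at h
    exact w.2 _ h
  induction f using Quotient.inductionOn with | _ c
  induction f' using Quotient.inductionOn with | _ c'
  rcases c with d | w <;> rcases c' with d' | w'
  · exact hdart _ _ (hG.2 d.src d.src.2 d'.src d'.src.2) d d' rfl rfl
  · exact (hdart_iso d w').elim
  · exact (hdart_iso d' w).elim
  · rw [Subtype.ext (hiso w w'.1)]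
    exact .refl _

end Graph.RotationSystem

namespace Graph.PlaneEmbedding

open Matrix

variable {α β : Type*} {G : Graph α β} (P : G.PlaneEmbedding)

theorem faceCycleMatrix_mul_incMatrix_transpose [Fintype V(G)] [Fintype E(G)] [G.Loopless]
    (o : G.Orientation) : P.faceCycleMatrix o * o.incMatrixᵀ = 0 := by
  have h := P.signedIncidence_face_mul_incMatrix_transpose o
  ext f x
  exact congrFun (congrFun h f.1) x

theorem faceCycleMatrix_mul_reducedIncMatrix_transpose [Fintype V(G)] [Fintype E(G)] [G.Loopless]
    (o : G.Orientation) (v : V(G)) : P.faceCycleMatrix o * (o.reducedIncMatrix v)ᵀ = 0 := by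
  ext f x
  exact congrFun (congrFun (P.faceCycleMatrix_mul_incMatrix_transpose o) f) x.1

theorem faceCycleMatrix_mulVec_surjective [Finite V(G)] [Fintype E(G)] (hG : G.IsConnected)
    (o : G.Orientation) : Function.Surjective (P.faceCycleMatrix o).mulVec :=
  signedIncidence_submatrix_mulVec_surjective fun f => P.eqvGen_face hG o f P.outer

/-- Euler's formula: the number of face cycles and the rank of the reduced incidence matrix add up
to the number of edges. -/
theorem card_boundedFace_add [Fintype V(G)] [Fintype E(G)] (v : V(G)) :
    Fintype.card P.BoundedFace + Fintype.card {x : V(G) // x ≠ v} = Fintype.card E(G) := by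
  classical
  have h := P.isSpherical
  have := Fintype.ofFinite P.Face
  rw [RotationSystem.IsSpherical, Nat.card_eq_fintype_card, Nat.card_eq_fintype_card,
    Nat.card_eq_fintype_card] at h
  have h1 : Fintype.card P.BoundedFace = Fintype.card P.Face - 1 := by
    rw [← Set.card_ne_eq P.outer]
    exact Fintype.card_congr (Equiv.refl _)
  have h2 : Fintype.card {x : V(G) // x ≠ v} = Fintype.card V(G) - 1 := by
    rw [← Set.card_ne_eq v]
    exact Fintype.card_congr (Equiv.refl _)
  have h3 : 0 < Fintype.card P.Face := Fintype.card_pos_iff.2 ⟨P.outer⟩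
  have h4 : 0 < Fintype.card V(G) := Fintype.card_pos_iff.2 ⟨v⟩
  omega

open Classical in
/-- The cycle lattice and the cut lattice are orthogonal complements of each other, with a splitting
of the edge lattice over `ℤ`. -/
theorem exists_splitting [Fintype V(G)] [Fintype E(G)] [G.Loopless] (hG : G.IsConnected)
    (o : G.Orientation) (v : V(G)) :
    ∃ (R : Matrix E(G) P.BoundedFace ℤ) (S : Matrix E(G) {x : V(G) // x ≠ v} ℤ),
      P.faceCycleMatrix o * R = 1 ∧ o.reducedIncMatrix v * S = 1 ∧
        (P.faceCycleMatrix o)ᵀ * Rᵀ + S * o.reducedIncMatrix v = 1 := by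
  classical
  exact Matrix.exists_splitting (P.faceCycleMatrix_mulVec_surjective hG o)
    (hG.reducedIncMatrix_mulVec_surjective o v)
    (P.faceCycleMatrix_mul_reducedIncMatrix_transpose o v) (P.card_boundedFace_add v)

/-- The homomorphism from the edge lattice to the cokernel of `𝐁_G` induced by the face cycle
matrix. -/
def edgeToCoker [Fintype V(G)] [Fintype E(G)] (o : G.Orientation) :
    (E(G) → ℤ) →+ (P.BoundedFace → ℤ) ⧸ LinearMap.range (P.faceGramMatrix o).mulVecLin :=
  ((LinearMap.range (P.faceGramMatrix o).mulVecLin).mkQ ∘ₗ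
    (P.faceCycleMatrix o).mulVecLin).toAddMonoidHom

theorem edgeToCoker_surjective [Fintype V(G)] [Fintype E(G)] (hG : G.IsConnected)
    (o : G.Orientation) : Function.Surjective (P.edgeToCoker o) :=
  (Submodule.mkQ_surjective _).comp (P.faceCycleMatrix_mulVec_surjective hG o)

/-- Both kernels are the sum of the cycle lattice and the cut lattice. -/
theorem ker_edgeToJac_eq [Fintype V(G)] [Fintype E(G)] [G.Loopless] (hG : G.IsConnected)
    (o : G.Orientation) : o.edgeToJac.ker = (P.edgeToCoker o).ker := by
  classical
  obtain ⟨v⟩ := hG.1.to_subtype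
  obtain ⟨R, S, -, -, hRS⟩ := P.exists_splitting hG o v
  have hAD := P.faceCycleMatrix_mul_incMatrix_transpose o
  set A := P.faceCycleMatrix o with hAdef
  set D := o.incMatrix with hDdef
  have hDA : D * Aᵀ = 0 := by simpa using congrArg transpose hAD
  have hRS' : R * A + (o.reducedIncMatrix v)ᵀ * Sᵀ = 1 := by simpa using congrArg transpose hRS
  ext x
  have h2 : P.edgeToCoker o x = 0 ↔ ∃ y, (A * Aᵀ).mulVec y = A.mulVec x :=
    Submodule.Quotient.mk_eq_zero _
  rw [AddMonoidHom.mem_ker, AddMonoidHom.mem_ker, o.edgeToJac_eq_zero_iff, h2, ← hDdef]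
  constructor
  · rintro ⟨z, hz⟩
    -- `x - Dᵀ z` is a cycle, so the splitting writes it as a combination of face cycles.
    have hC : (o.reducedIncMatrix v).mulVec (x - Dᵀ.mulVec z) = 0 := by
      have h0 : D.mulVec (x - Dᵀ.mulVec z) = 0 := by
        rw [mulVec_sub, mulVec_mulVec, hz, sub_self]
      ext u
      exact congrFun h0 u.1
    have hx := congrArg (fun M => A.mulVec (M.mulVec (x - Dᵀ.mulVec z))) hRS
    simp only [add_mulVec, ← mulVec_mulVec _ S, hC, mulVec_zero, add_zero, one_mulVec] at hx
    rw [mulVec_sub A x, mulVec_mulVec _ A Dᵀ, hAD, zero_mulVec, sub_zero] at hx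
    exact ⟨Rᵀ.mulVec (x - Dᵀ.mulVec z), by
      rw [← hx]; simp only [mulVec_mulVec, Matrix.mul_assoc]⟩
  · rintro ⟨y, hy⟩
    -- `x - Aᵀ y` is orthogonal to all face cycles, so the splitting writes it as a cut.
    have hA : A.mulVec (x - Aᵀ.mulVec y) = 0 := by
      rw [mulVec_sub, mulVec_mulVec, hy, sub_self]
    obtain ⟨z, hz⟩ := transpose_submatrix_val_mulVec D (· ≠ v)
      (Sᵀ.mulVec (x - Aᵀ.mulVec y))
    have hx := congrArg (fun M => D.mulVec (M.mulVec (x - Aᵀ.mulVec y))) hRS'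
    simp only [add_mulVec, ← mulVec_mulVec _ R, hA, mulVec_zero, zero_add, one_mulVec] at hx
    rw [mulVec_sub D x, mulVec_mulVec _ D Aᵀ, hDA, zero_mulVec, sub_zero] at hx
    exact ⟨z, by rw [← hx, ← mulVec_mulVec, ← mulVec_mulVec, ← hz]; rfl⟩

end Graph.PlaneEmbedding

end

theorem mainTheorem2 {α β : Type*} (G : Graph α β) [Fintype V(G)] [Fintype E(G)] [G.Loopless]
    (hG : G.IsConnected) (P : G.PlaneEmbedding) (o : G.Orientation) (v : V(G)) :
    (∃ s : List ℕ, HasInvariantFactors (P.faceGramMatrix o) s ∧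
      HasInvariantFactors (G.reducedLaplacian v) s) ∧
    Nonempty (G.Jac ≃+
      ((P.BoundedFace → ℤ) ⧸ LinearMap.range (P.faceGramMatrix o).mulVecLin)) := by
  classical
  obtain ⟨R, S, hR, hS, hRS⟩ := P.exists_splitting hG o v
  constructor
  · rw [Graph.reducedLaplacian_eq o, Graph.PlaneEmbedding.faceGramMatrix]
    exact exists_hasInvariantFactors_mul_transpose hR hS
      (P.faceCycleMatrix_mul_reducedIncMatrix_transpose o v) hRS
  · exact ⟨((QuotientAddGroup.quotientKerEquivOfSurjective _
        (hG.edgeToJac_surjective o)).symm.trans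
      (QuotientAddGroup.quotientAddEquivOfEq (P.ker_edgeToJac_eq hG o))).trans
      (QuotientAddGroup.quotientKerEquivOfSurjective _ (P.edgeToCoker_surjective hG o))⟩
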